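/- Let $R$ be a local domain (not assumed noetherian or integrally closed) with maximal ideal $m_R$ and fraction field $K$, and let $R\to R^h$ be its henselization: $R^h$ is a henselian local ring, $R\to R^h$ is a local homomorphism, and every local homomorphism from $R$ to a henselian local ring factors through $R\to R^h$ by a unique local homomorphism. A valuation $\mu$ of the fraction field of a local domain $A$ is said to be *centered in* $A$ if $\mu\ge 0$ on $A$ and the maximal ideal of $A$ is $\{a\in A : \mu(a)>0\}$ (with $\mu(0)=\infty$). If $K\hookrightarrow L$ is a field extension, a valuation $\tilde\nu$ of $L$ *extends* a valuation $\nu$ of $K$ if their valuation rings satisfy $R_{\tilde\nu}\cap K=R_\nu$. Valuations with the same valuation ring are identified. Let $\nu$ be a valuation of $K$ centered in $R$. Then: 1. There exists a unique prime ideal $H(\nu)$ of $R^h$ lying over the zero ideal of $R$ such that $\nu$ extends, through the inclusion $R\subset R^h/H(\nu)$, to a valuation $\tilde\nu$ of the fraction field of $R^h/H(\nu)$ that is centered in $R^h/H(\nu)$. In addition, $H(\nu)$ is a minimal prime of $R^h$, and the extension $\tilde\nu$ is unique. 2. The valuations $\nu$ and $\tilde\nu$ have the same value group: the canonical injection of ordered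 groups $\nu(K\setminus\{0\})\to\tilde\nu(\mathrm{Frac}(R^h/H(\nu))\setminus\{0\})$ is an isomorphism. -/

import Mathlib

universe u v w

open IsLocalRing

/-- `Rh` is a henselization of the local ring `R`: it is a henselian local ring, `R → Rh` is a local
homomorphism, and every local homomorphism from `R` to a henselian local ring `T` factors through
`R → Rh` by a unique local homomorphism. -/
structure IsHenselization (R Rh : Type u) [CommRing R] [IsLocalRing R] [CommRing Rh]
    [Algebra R Rh] : Prop where
  henselianLocalRing : HenselianLocalRing Rh
  isLocalHom_algebraMap : IsLocalHom (algebraMap R Rh)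
  existsUnique_lift : ∀ (T : Type u) [CommRing T] [HenselianLocalRing T] (f : R →+* T),
    IsLocalHom f → ∃! g : Rh →+* T, IsLocalHom g ∧ g.comp (algebraMap R Rh) = f

/-- A valuation of a field `L` containing the local domain `A` is centered in `A` if it is
nonnegative on `A` (multiplicatively, `≤ 1`) and the maximal ideal of `A` is the set of elements
of positive value (multiplicatively, `< 1`). It is used when `L` is the fraction field of `A`. -/
def IsCenteredIn (A : Type*) [CommRing A] [IsLocalRing A] {L : Type*} [Field L] [Algebra A L]
    {Γ : Type*} [LinearOrderedCommGroupWithZero Γ] (μ : Valuation L Γ) : Prop :=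
  (∀ a : A, μ (algebraMap A L a) ≤ 1) ∧
    ∀ a : A, a ∈ maximalIdeal A ↔ μ (algebraMap A L a) < 1

/-- Along a field embedding `i : K → L`, the valuation `μ` of `L` extends the valuation `ν` of `K`:
the valuation ring of `μ` meets `K` in the valuation ring of `ν`. -/
def ValuationExtends {K L : Type*} [Field K] [Field L] (i : K →+* L)
    {Γ Γ' : Type*} [LinearOrderedCommGroupWithZero Γ] [LinearOrderedCommGroupWithZero Γ']
    (ν : Valuation K Γ) (μ : Valuation L Γ') : Prop :=
  μ.valuationSubring.comap i = ν.valuationSubring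

/-- Along a field embedding `i : K → L`, the valuations `ν` and `μ` have the same value group:
there is an isomorphism of ordered groups (with zero adjoined) from the value group of `ν` onto that
of `μ` carrying `ν x` to `μ (i x)`. `ValueGroup₀` is generated by the values actually taken. -/
def SameValueGroup {K L : Type*} [Field K] [Field L] (i : K →+* L)
    {Γ Γ' : Type*} [LinearOrderedCommGroupWithZero Γ] [LinearOrderedCommGroupWithZero Γ']
    (ν : Valuation K Γ) (μ : Valuation L Γ') : Prop :=
  ∃ e : MonoidWithZeroHom.ValueGroup₀ (.ofClass ν) ≃*o MonoidWithZeroHom.ValueGroup₀ (.ofClass μ),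
    ∀ x : K, e (ν.restrict x) = μ.restrict (i x)

instance isLocalRing_quotient_prime (A : Type*) [CommRing A] [IsLocalRing A] (H : Ideal A)
    [H.IsPrime] : IsLocalRing (A ⧸ H) :=
  .of_surjective' (Ideal.Quotient.mk H) Ideal.Quotient.mk_surjective

theorem algebraMap_fractionRing_quotient_injective (R : Type*) [CommRing R] {A : Type*}
    [CommRing A] [Algebra R A] (H : Ideal A) [H.LiesOver (⊥ : Ideal R)] :
    Function.Injective (algebraMap R (FractionRing (A ⧸ H))) := by
  rw [IsScalarTower.algebraMap_eq R (A ⧸ H) (FractionRing (A ⧸ H))]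
  refine (IsFractionRing.injective (A ⧸ H) (FractionRing (A ⧸ H))).comp ?_
  refine (injective_iff_map_eq_zero (algebraMap R (A ⧸ H))).mpr fun a ha => ?_
  have h : algebraMap R A a ∈ H := Ideal.Quotient.eq_zero_iff_mem.mp ha
  simpa using (Ideal.mem_of_liesOver H (⊥ : Ideal R) a).mpr h

/-- For a prime `H` of `A` lying over the zero ideal of the domain `R`, the embedding of the
fraction field `K` of `R` into the fraction field of `A ⧸ H` extending `R ⊆ A ⧸ H`. -/
noncomputable def fractionFieldEmbedding (R : Type*) [CommRing R] {A : Type*} [CommRing A]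
    [Algebra R A] (H : Ideal A) [H.IsPrime] [H.LiesOver (⊥ : Ideal R)]
    (K : Type*) [Field K] [Algebra R K] [IsFractionRing R K] :
    K →+* FractionRing (A ⧸ H) :=
  IsFractionRing.lift (algebraMap_fractionRing_quotient_injective R H)

/-- For a prime `H` of the local ring `A` lying over the zero ideal of the domain `R` with fraction
field `K`, the valuation `μ` of the fraction field of `A ⧸ H` is an extension of the valuation `ν`
of `K` and is centered in `A ⧸ H`. -/
def IsCenteredExtension (R : Type*) [CommRing R] {K : Type*} [Field K]
    [Algebra R K] [IsFractionRing R K] {A : Type*} [CommRing A] [IsLocalRing A] [Algebra R A]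
    {Γ Γ' : Type*} [LinearOrderedCommGroupWithZero Γ] [LinearOrderedCommGroupWithZero Γ']
    (ν : Valuation K Γ) (H : Ideal A) [H.IsPrime] [H.LiesOver (⊥ : Ideal R)]
    (μ : Valuation (FractionRing (A ⧸ H)) Γ') : Prop :=
  ValuationExtends (fractionFieldEmbedding R H K) ν μ ∧ IsCenteredIn (A ⧸ H) μ

/-! Existence comes from a henselian valuation ring `T` that dominates the valuation ring `V` of `ν`
and takes no new values (`exists_henselian_same_values`). The universal property gives a local map
`Rh → T`. Its kernel is `H`, and restricting `T` to the fraction field of `Rh ⧸ H` gives the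
extension. That field lies between `K` and the fraction field of `T`, so the value group stays the
same. To build `T`, extend `V` to an algebraic closure and take an intermediate field `L` maximal
among those without new values. If a simple approximate root `a₀` over `L` lifts to `α`, then `α -
a₀` is the only one among its conjugates that is not a unit. A Newton polygon argument then shows
that adjoining it creates no new values, so `α ∈ L` by maximality. Uniqueness comes from
amalgamation (`exists_henselian_amalgam`): any two local domains dominating `V` embed in a common
henselian valuation ring. There the two maps from `Rh` agree by uniqueness of lifts, so their
kernels agree, and so do the valuation rings. Minimality of `H` (`IsHenselization.eq_ker_of_le`) is
the same uniqueness, applied to a map whose kernel is a smaller prime. -/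

/-! ### Newton polygons: dominant terms and isolated roots. -/

section Dominant

open Polynomial

variable {N : Type*} [Field N] {Γ₀ : Type*} [LinearOrderedCommGroupWithZero Γ₀]

/-- The `k`-th term of `Q` has value `c` at radius `ρ`, and every other term has smaller value. -/
def HasDominantTerm (w : Valuation N Γ₀) (ρ : Γ₀) (Q : N[X]) (k : ℕ) (c : Γ₀) : Prop :=
  w (Q.coeff k) * ρ ^ k = c ∧ ∀ j, j ≠ k → w (Q.coeff j) * ρ ^ j < c

/-- At radius `ρ` the term `X` outweighs the constant `z`, so multiplication by `X - C z` acts like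
multiplication by `X` and shifts the dominant index. In the companion lemma for `ρ < w z` the
constant wins and the index stays. -/
theorem HasDominantTerm.X_sub_C_mul_of_lt {w : Valuation N Γ₀} {ρ : Γ₀} {Q : N[X]} {k : ℕ}
    {c : Γ₀} (hρ : ρ ≠ 0) (h : HasDominantTerm w ρ Q k c) {z : N} (hz : w z < ρ) :
    HasDominantTerm w ρ ((X - C z) * Q) (k + 1) (c * ρ) := by
  have hρ' : 0 < ρ := zero_lt_iff.mpr hρ
  obtain ⟨hk, hlt⟩ := h
  have hcoef : ∀ j, w ((C z * Q).coeff j) * ρ ^ j < c * ρ := by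
    intro j
    have hj : w (Q.coeff j) * ρ ^ j ≤ c := by
      by_cases e : j = k
      · rw [e, hk]
      · exact (hlt j e).le
    -- The index `k + 1` serves only as one different from `k`: strictness there forces `c` to be
    -- positive.
    have hc : 0 < c := lt_of_le_of_lt zero_le (hlt (k + 1) (by omega))
    rw [coeff_C_mul, map_mul, mul_assoc, mul_comm c]
    calc w z * (w (Q.coeff j) * ρ ^ j) ≤ w z * c := by gcongr
      _ < ρ * c := by gcongr
  rw [sub_mul]
  constructor
  · have h1 : w ((X * Q).coeff (k + 1)) * ρ ^ (k + 1) = c * ρ := by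
      rw [coeff_X_mul, pow_succ, ← mul_assoc, hk]
    have h2 : w ((C z * Q).coeff (k + 1)) < w ((X * Q).coeff (k + 1)) := by
      have := hcoef (k + 1)
      rw [← h1] at this
      exact lt_of_mul_lt_mul_right' this
    rw [coeff_sub, Valuation.map_sub_eq_of_lt_left _ h2, h1]
  · intro j hj
    have h1 : w ((X * Q).coeff j) * ρ ^ j < c * ρ := by
      cases j with
      | zero => simpa using lt_of_le_of_lt zero_le (hcoef 0)
      | succ j =>
        rw [coeff_X_mul, pow_succ, ← mul_assoc]
        have := hlt j (by omega)
        gcongr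
    rw [coeff_sub]
    rcases le_max_iff.mp (w.map_sub ((X * Q).coeff j) ((C z * Q).coeff j)) with h | h
    · exact lt_of_le_of_lt (mul_le_mul_left h _) h1
    · exact lt_of_le_of_lt (mul_le_mul_left h _) (hcoef j)

theorem HasDominantTerm.X_sub_C_mul_of_gt {w : Valuation N Γ₀} {ρ : Γ₀} {Q : N[X]} {k : ℕ}
    {c : Γ₀} (hρ : ρ ≠ 0) (h : HasDominantTerm w ρ Q k c) {z : N} (hz : ρ < w z) :
    HasDominantTerm w ρ ((X - C z) * Q) k (w z * c) := by
  have hρ' : 0 < ρ := zero_lt_iff.mpr hρ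
  obtain ⟨hk, hlt⟩ := h
  have hc : 0 < c := lt_of_le_of_lt zero_le (hlt (k + 1) (by omega))
  have hwz : 0 < w z := hρ'.trans hz
  have hcoef : ∀ j, w ((X * Q).coeff j) * ρ ^ j < w z * c := by
    intro j
    cases j with
    | zero => simp [hc, hwz]
    | succ j =>
      have hj : w (Q.coeff j) * ρ ^ j ≤ c := by
        by_cases e : j = k
        · rw [e, hk]
        · exact (hlt j e).le
      rw [coeff_X_mul, pow_succ, ← mul_assoc]
      calc w (Q.coeff j) * ρ ^ j * ρ ≤ c * ρ := by gcongr
        _ < c * w z := by gcongr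
        _ = w z * c := mul_comm _ _
  rw [sub_mul]
  constructor
  · have h1 : w ((C z * Q).coeff k) * ρ ^ k = w z * c := by
      rw [coeff_C_mul, map_mul, mul_assoc, hk]
    have h2 : w ((X * Q).coeff k) < w ((C z * Q).coeff k) := by
      have := hcoef k
      rw [← h1] at this
      exact lt_of_mul_lt_mul_right' this
    rw [coeff_sub, Valuation.map_sub_eq_of_lt_right _ h2, h1]
  · intro j hj
    have h1 : w ((C z * Q).coeff j) * ρ ^ j < w z * c := by
      rw [coeff_C_mul, map_mul, mul_assoc]
      have := hlt j hj
      gcongr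
    rw [coeff_sub]
    rcases le_max_iff.mp (w.map_sub ((X * Q).coeff j) ((C z * Q).coeff j)) with h | h
    · exact lt_of_le_of_lt (mul_le_mul_left h _) (hcoef j)
    · exact lt_of_le_of_lt (mul_le_mul_left h _) h1

theorem exists_hasDominantTerm_prod (w : Valuation N Γ₀) {ρ : Γ₀} (hρ : ρ ≠ 0) (s : Multiset N)
    (hs : ∀ z ∈ s, w z ≠ ρ) :
    ∃ k c, HasDominantTerm w ρ (s.map fun z => X - C z).prod k c := by
  induction s using Multiset.induction_on with
  | empty =>
    refine ⟨0, 1, by simp, fun j hj => ?_⟩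
    simp [coeff_one, hj]
  | cons z s ih =>
    obtain ⟨k, c, h⟩ := ih fun y hy => hs y (Multiset.mem_cons_of_mem hy)
    rw [Multiset.map_cons, Multiset.prod_cons]
    rcases lt_or_gt_of_ne (hs z (Multiset.mem_cons_self z s)) with hz | hz
    · exact ⟨_, _, h.X_sub_C_mul_of_lt hρ hz⟩
    · exact ⟨_, _, h.X_sub_C_mul_of_gt hρ hz⟩

/-- If exactly one root of a polynomial has a given value, this value is the quotient of the values
of two consecutive coefficients. -/
theorem exists_coeff_of_isolated_root (w : Valuation N Γ₀) {z : N} (hz : z ≠ 0) (s : Multiset N)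
    (hs : ∀ y ∈ s, w y ≠ w z) :
    ∃ k, w (((X - C z) * (s.map fun z => X - C z).prod).coeff k) =
      w z * w (((X - C z) * (s.map fun z => X - C z).prod).coeff (k + 1)) ∧
      w (((X - C z) * (s.map fun z => X - C z).prod).coeff (k + 1)) ≠ 0 := by
  have hρ : w z ≠ 0 := w.ne_zero_iff.mpr hz
  have hρ' : 0 < w z := zero_lt_iff.mpr hρ
  obtain ⟨k, c, hk, hlt⟩ := exists_hasDominantTerm_prod w hρ s hs
  set Q := (s.map fun z => X - C z).prod
  have hc : 0 < c := lt_of_le_of_lt zero_le (hlt (k + 1) (by omega))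
  -- With `Q` dominant at `k`, the coefficient `Q_k - z Q_{k+1}` has the value of its first term,
  -- and the coefficient `Q_{k-1} - z Q_k` below it that of its second. The quotient of these values
  -- is `w z`.
  have h1 : w (((X - C z) * Q).coeff (k + 1)) = w (Q.coeff k) := by
    rw [sub_mul, coeff_sub, coeff_X_mul, coeff_C_mul]
    refine Valuation.map_sub_eq_of_lt_left _ ?_
    have := hlt (k + 1) (by omega)
    rw [← hk, pow_succ', ← mul_assoc, mul_comm _ (w z), ← map_mul] at this
    exact lt_of_mul_lt_mul_right' this
  have h2 : w (((X - C z) * Q).coeff k) = w z * w (Q.coeff k) := by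
    rw [sub_mul, coeff_sub, coeff_C_mul, ← map_mul]
    refine Valuation.map_sub_eq_of_lt_right _ ?_
    cases k with
    | zero =>
      simp only [coeff_X_mul_zero, map_zero, map_mul]
      refine zero_lt_iff.mpr (mul_ne_zero hρ ?_)
      rintro e
      simp [e] at hk
      exact hc.ne hk
    | succ k =>
      have := hlt k (by omega)
      rw [← hk, pow_succ', ← mul_assoc] at this
      rw [coeff_X_mul, map_mul, mul_comm]
      exact lt_of_mul_lt_mul_right' this
  refine ⟨k, by rw [h1, h2], ?_⟩
  rw [h1]
  intro e
  rw [e, zero_mul] at hk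
  exact hc.ne hk

end Dominant

/-! ### Lifting roots in valuation rings of algebraically closed fields. -/

section SimpleRoot

open Polynomial

theorem exists_isRoot_of_isAlgClosed {N : Type*} [Field N] [IsAlgClosed N] (W : ValuationSubring N)
    (f : W[X]) (hf : f.Monic) (hd : f.natDegree ≠ 0) : ∃ a : W, f.IsRoot a := by
  obtain ⟨z, hz⟩ := IsAlgClosed.exists_aeval_eq_zero N f (by
    rw [degree_eq_natDegree hf.ne_zero]; exact_mod_cast hd)
  obtain ⟨a, rfl⟩ := IsIntegrallyClosed.isIntegral_iff.mp (⟨f, hf, hz⟩ : IsIntegral W z)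
  refine ⟨a, ?_⟩
  rw [aeval_algebraMap_apply_eq_algebraMap_eval] at hz
  exact IsFractionRing.injective W N (by simpa using hz)

/-- Split off a root `b`, so that `f = (X - b) h`. The maximal ideal is prime, hence contains `a₀ -
b` or `h(a₀)`: either `b` is the required root, or `h` has smaller degree and the same property.
Simplicity of the approximate root plays no role. -/
theorem exists_isRoot_sub_mem_of_isAlgClosed {N : Type*} [Field N] [IsAlgClosed N]
    (W : ValuationSubring N) (f : W[X]) (hf : f.Monic) (a₀ : W)
    (ha : f.eval a₀ ∈ maximalIdeal W) : ∃ a : W, f.IsRoot a ∧ a - a₀ ∈ maximalIdeal W := by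
  induction hn : f.natDegree generalizing f with
  | zero =>
    rw [hf.natDegree_eq_zero.mp hn, eval_one] at ha
    exact absurd ha ((Ideal.ne_top_iff_one _).mp (maximalIdeal.isMaximal W).ne_top)
  | succ n ih =>
    obtain ⟨b, hb⟩ := exists_isRoot_of_isAlgClosed W f hf (by omega)
    obtain ⟨h, rfl⟩ := dvd_iff_isRoot.mpr hb
    have hh : h.Monic := (monic_X_sub_C b).of_mul_monic_left hf
    rw [eval_mul, eval_sub, eval_X, eval_C] at ha
    rcases Ideal.IsPrime.mem_or_mem (inferInstance : (maximalIdeal W).IsPrime) ha with h1 | h1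
    · exact ⟨b, hb, by simpa using neg_mem h1⟩
    · rw [(monic_X_sub_C b).natDegree_mul hh, natDegree_X_sub_C] at hn
      obtain ⟨a, h2, h3⟩ := ih h hh h1 (by omega)
      exact ⟨a, by simp [IsRoot.def, h2.eq_zero], h3⟩

theorem henselianLocalRing_of_isAlgClosed {N : Type*} [Field N] [IsAlgClosed N]
    (W : ValuationSubring N) : HenselianLocalRing W where
  is_henselian f hf a₀ ha _ := exists_isRoot_sub_mem_of_isAlgClosed W f hf a₀ ha

/-- A simple root modulo the maximal ideal of a local domain lifts to at most one root, which is
simple and whose distance to the approximate root is controlled. -/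
theorem isolated_root_of_isUnit_derivative {A : Type*} [CommRing A] [IsDomain A] [IsLocalRing A]
    {f : A[X]} {a₀ α : A} (hα : f.IsRoot α) (hm : α - a₀ ∈ maximalIdeal A)
    (hu : IsUnit (f.derivative.eval a₀)) :
    Associated (α - a₀) (f.eval a₀) ∧ IsUnit (f.derivative.eval α) ∧
      ∀ β, f.IsRoot β → β ≠ α → IsUnit (β - a₀) := by
  -- Write `f = (X - α) h`. Then `h(a₀)` is congruent to `f'(a₀)`, hence a unit. This gives all
  -- three claims: `f(a₀) = (a₀ - α) h(a₀)`, `f'(α) = h(α)`, and for another root `β` the factor `a₀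
  -- - β` divides the unit `h(a₀)`.
  obtain ⟨h, rfl⟩ := dvd_iff_isRoot.mpr hα
  have hd : ∀ x, ((X - C α) * h).derivative.eval x = h.eval x + (x - α) * h.derivative.eval x := by
    intro x; simp [derivative_mul]
  have key : ∀ x y : A, IsUnit x → y - x ∈ maximalIdeal A → IsUnit y := by
    intro x y hx hy
    by_contra hy'
    have := sub_mem ((mem_maximalIdeal y).mpr hy') hy
    rw [sub_sub_cancel] at this
    exact this hx
  have h0 : IsUnit (h.eval a₀) := by
    refine key _ _ hu ?_
    rw [hd]
    have : h.eval a₀ - (h.eval a₀ + (a₀ - α) * h.derivative.eval a₀) =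
      (α - a₀) * h.derivative.eval a₀ := by ring
    rw [this]
    exact Ideal.mul_mem_right _ _ hm
  refine ⟨?_, ?_, fun β hβ hne => ?_⟩
  · refine ⟨-h0.unit, ?_⟩
    simp only [Units.val_neg, IsUnit.unit_spec, eval_mul, eval_sub, eval_X, eval_C]
    ring
  · rw [hd, sub_self, zero_mul, add_zero]
    exact key _ _ h0 (Ideal.mem_of_dvd _ (sub_dvd_eval_sub α a₀ h) hm)
  · have hβ' : h.IsRoot β := by
      rw [IsRoot.def, eval_mul, mul_eq_zero] at hβ
      refine hβ.resolve_left ?_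
      simpa [sub_eq_zero] using hne
    obtain ⟨g, rfl⟩ := dvd_iff_isRoot.mpr hβ'
    rw [eval_mul, eval_sub, eval_X, eval_C] at h0
    simpa using (isUnit_of_mul_isUnit_left h0).neg

end SimpleRoot

/-! ### Values on a simple separable extension. -/

section ValueGroup

open Polynomial

variable {L N : Type*} [Field L] [Field N] [Algebra L N] {Γ₀ : Type*}
  [LinearOrderedCommGroupWithZero Γ₀]

/-- If all other conjugates of a separable element have a value different from its own, then its
value is taken on the base field. -/
theorem exists_valuation_eq_of_isolated_conjugate [IsAlgClosed N] [Algebra.IsAlgebraic L N]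
    (w : Valuation N Γ₀) {z : N} (hsep : IsSeparable L z)
    (hz : ∀ σ : N ≃ₐ[L] N, σ z ≠ z → w (σ z) ≠ w z) :
    ∃ y : L, w z = w (algebraMap L N y) := by
  by_cases hz0 : z = 0
  · exact ⟨0, by simp [hz0]⟩
  have hint : IsIntegral L z := Algebra.IsIntegral.isIntegral z
  set P := (minpoly L z).map (algebraMap L N) with hP
  have hmon : P.Monic := (minpoly.monic hint).map _
  have hspl : P.Splits := IsAlgClosed.splits P
  have hmem : z ∈ P.roots := by
    rw [mem_roots hmon.ne_zero, IsRoot.def, eval_map_algebraMap, minpoly.aeval]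
  obtain ⟨s, hs⟩ := Multiset.exists_cons_of_mem hmem
  -- Separability makes `z` a simple root, so `s` consists of conjugates different from `z`.
  have hnodup : P.roots.Nodup := nodup_roots (Separable.map hsep)
  have hprod : P = (X - C z) * (s.map fun z => X - C z).prod := by
    conv_lhs => rw [hspl.eq_prod_roots_of_monic hmon, hs, Multiset.map_cons, Multiset.prod_cons]
  obtain ⟨k, hk, hk0⟩ := exists_coeff_of_isolated_root w hz0 s (fun y hy => by
    have hyr : y ∈ P.roots := hs ▸ Multiset.mem_cons_of_mem hy
    have hyz : y ≠ z := by
      rintro rfl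
      rw [hs, Multiset.nodup_cons] at hnodup
      exact hnodup.1 hy
    have hconj : IsConjRoot L z y := by
      rw [isConjRoot_iff_aeval_eq_zero hint, ← eval_map_algebraMap]
      exact (mem_roots hmon.ne_zero).mp hyr
    have : Normal L N := normal_iff.mpr fun x =>
      ⟨Algebra.IsIntegral.isIntegral x, IsAlgClosed.splits _⟩
    obtain ⟨σ, rfl⟩ := hconj.symm.exists_algEquiv
    exact hz σ hyz)
  rw [← hprod, hP, coeff_map, coeff_map] at hk
  rw [← hprod, hP, coeff_map] at hk0
  refine ⟨(minpoly L z).coeff k / (minpoly L z).coeff (k + 1), ?_⟩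
  rw [map_div₀, map_div₀, hk, mul_div_assoc, div_self hk0, mul_one]

theorem exists_pow_mul_notMem {a b : Γ₀} (ha : a < 1) (ha0 : a ≠ 0) (hb : b ≠ 0) {s : Set Γ₀}
    (hs : s.Finite) : ∃ n : ℕ, a ^ n * b ∉ s := by
  by_contra! h
  refine Set.infinite_of_injective_forall_mem (f := fun n : ℕ => a ^ n * b) ?_ h hs
  intro m n hmn
  have h1 : a ^ m = a ^ n := mul_right_cancel₀ hb hmn
  exact (pow_right_strictAnti₀ (zero_lt_iff.mpr ha0) ha).injective h1

/-- Let `α` be a separable element such that all its other conjugates over `L` are units with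
respect to `w`, while `α` is not. Then adjoining `α` does not change the value group. -/
theorem exists_valuation_eq_of_mem_adjoin [IsAlgClosed N] [Algebra.IsAlgebraic L N]
    (w : Valuation N Γ₀) {α : N} (hsep : IsSeparable L α) (h1 : w α < 1)
    (hconj : ∀ σ : N ≃ₐ[L] N, σ α ≠ α → w (σ α) = 1)
    (hα : ∃ y : L, w α = w (algebraMap L N y)) {x : N} (hx : x ∈ IntermediateField.adjoin L {α}) :
    ∃ y : L, w x = w (algebraMap L N y) := by
  by_cases hα0 : α = 0
  · subst hα0
    rw [IntermediateField.adjoin_zero, IntermediateField.mem_bot] at hx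
    obtain ⟨y, rfl⟩ := hx
    exact ⟨y, rfl⟩
  by_cases hx0 : x = 0
  · exact ⟨0, by simp [hx0]⟩
  have hint : ∀ z : N, IsIntegral L z := fun z => Algebra.IsIntegral.isIntegral z
  have hfin : (Set.range fun σ : N ≃ₐ[L] N => w (σ x)).Finite := by
    refine (((minpoly L x).aroots N).finite_toSet.image w).subset ?_
    rintro _ ⟨σ, rfl⟩
    refine ⟨σ x, ?_, rfl⟩
    exact (isConjRoot_iff_mem_minpoly_aroots (hint x)).mp (isConjRoot_of_algEquiv x σ)
  -- The exponent makes the value of `α ^ n * x` differ from the value of every conjugate of `x`. If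
  -- `σ` moves `α`, then `σ α` is a unit, so `σ (α ^ n * x)` has the value of `σ x`. Thus `α ^ n *
  -- x` is isolated among its conjugates.
  obtain ⟨n, hn⟩ := exists_pow_mul_notMem h1 (w.ne_zero_iff.mpr hα0) (w.ne_zero_iff.mpr hx0) hfin
  have : Algebra.IsSeparable L (IntermediateField.adjoin L {α}) :=
    (IntermediateField.isSeparable_adjoin_simple_iff_isSeparable L N).mpr hsep
  have hz : α ^ n * x ∈ IntermediateField.adjoin L {α} :=
    mul_mem (pow_mem (IntermediateField.mem_adjoin_simple_self L α) n) hx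
  obtain ⟨y, hy⟩ := exists_valuation_eq_of_isolated_conjugate w (z := α ^ n * x)
    (IntermediateField.isSeparable_of_mem_isSeparable L N hz) (fun σ hσ e => by
      have hσα : σ α ≠ α := by
        intro e'
        apply hσ
        have : IntermediateField.adjoin L {α} ≤
            IntermediateField.fixedField (Subgroup.zpowers σ) := by
          rw [IntermediateField.adjoin_simple_le_iff, IntermediateField.mem_fixedField_iff]
          rintro τ hτ
          exact (Subgroup.zpowers_le (H := MulAction.stabilizer (N ≃ₐ[L] N) α)).mpr e' hτ
        exact (IntermediateField.mem_fixedField_iff _ _).mp (this hz) σ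
          (Subgroup.mem_zpowers σ)
      apply hn
      refine ⟨σ, ?_⟩
      rw [map_mul, map_pow, map_mul, map_pow, hconj σ hσα, one_pow, one_mul, map_mul, map_pow] at e
      exact e)
  obtain ⟨c, hc⟩ := hα
  refine ⟨y / c ^ n, ?_⟩
  rw [map_div₀, map_div₀, ← hy, map_pow, map_pow, map_mul, map_pow, hc, mul_comm, mul_div_assoc,
    div_self, mul_one]
  rw [← hc]
  exact pow_ne_zero _ (w.ne_zero_iff.mpr hα0)

end ValueGroup

/-! ### A henselian extension without new values. -/

section HenselianExtension

open Polynomial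

/-- A valuation ring dominating another one lies over it. -/
theorem ValuationSubring.comap_eq_of_dominates {K F : Type*} [Field K] [Field F] (i : K →+* F)
    (V : ValuationSubring K) (W : ValuationSubring F) (h : ∀ x ∈ V, i x ∈ W)
    (h' : ∀ x ∈ V.nonunits, i x ∈ W.nonunits) : W.comap i = V := by
  refine le_antisymm (fun x hx => ?_) h
  by_contra hxV
  have hx0 : x ≠ 0 := fun e => hxV (e ▸ V.zero_mem)
  have h1 : x⁻¹ ∈ V.nonunits := (V.inv_mem_nonunits_iff).mpr (Or.inr hxV)
  have h2 := h' _ h1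
  rw [map_inv₀, W.inv_mem_nonunits_iff] at h2
  rcases h2 with h2 | h2
  · exact hx0 ((map_eq_zero i).mp h2)
  · exact h2 hx

theorem ValuationSubring.exists_comap_eq {K F : Type*} [Field K] [Field F] (i : K →+* F)
    (V : ValuationSubring K) : ∃ W : ValuationSubring F, W.comap i = V := by
  obtain ⟨W, h, hloc⟩ := IsLocalRing.exists_factor_valuationRing (i.comp V.subtype)
  refine ⟨W, ValuationSubring.comap_eq_of_dominates i V W (fun x hx => h ⟨x, hx⟩) ?_⟩
  intro x hx
  obtain ⟨hxV, hu⟩ := V.mem_nonunits_iff_exists_mem_maximalIdeal.mp hx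
  refine W.mem_nonunits_iff_exists_mem_maximalIdeal.mpr ⟨h ⟨x, hxV⟩, ?_⟩
  exact fun hunit => hu (hloc.map_nonunit _ hunit)

/-- The local homomorphism of valuation rings induced by an extension of valued fields. -/
def ValuationSubring.mapOfComapEq {K F : Type*} [Field K] [Field F] (i : K →+* F)
    {V : ValuationSubring K} {W : ValuationSubring F} (h : W.comap i = V) : V →+* W :=
  (i.comp V.subtype).codRestrict W.toSubring fun x => h.ge x.2

theorem ValuationSubring.coe_mapOfComapEq {K F : Type*} [Field K] [Field F] (i : K →+* F)
    {V : ValuationSubring K} {W : ValuationSubring F} (h : W.comap i = V) (x : V) :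
    (mapOfComapEq i h x : F) = i x := rfl

theorem ValuationSubring.mapOfComapEq_injective {K F : Type*} [Field K] [Field F] (i : K →+* F)
    {V : ValuationSubring K} {W : ValuationSubring F} (h : W.comap i = V) :
    Function.Injective (mapOfComapEq i h) := fun _ _ hxy =>
  Subtype.ext (i.injective (congrArg Subtype.val hxy))

instance ValuationSubring.isLocalHom_mapOfComapEq {K F : Type*} [Field K] [Field F] (i : K →+* F)
    {V : ValuationSubring K} {W : ValuationSubring F} (h : W.comap i = V) :
    IsLocalHom (mapOfComapEq i h) where
  map_nonunit x hx := by
    obtain ⟨y, hy⟩ := isUnit_iff_exists_inv.mp hx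
    have hy' : i x * (y : F) = 1 := congrArg Subtype.val hy
    have hx0 : (x : K) ≠ 0 := fun e => by simp [e] at hy'
    have hmem : (x : K)⁻¹ ∈ V := by
      refine h.le ?_
      rw [ValuationSubring.mem_comap, map_inv₀, ← eq_inv_of_mul_eq_one_right hy']
      exact y.2
    exact isUnit_iff_exists_inv.mpr ⟨⟨_, hmem⟩, Subtype.ext (mul_inv_cancel₀ hx0)⟩

variable {K N : Type*} [Field K] [Field N] [Algebra K N]

theorem exists_maximal_same_values {Γ₀ : Type*} [LinearOrderedCommGroupWithZero Γ₀]
    (w : Valuation N Γ₀) : ∃ L : IntermediateField K N,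
    Maximal (fun L => ∀ x ∈ L, ∃ y : K, w x = w (algebraMap K N y)) L := by
  refine zorn_le₀ {L : IntermediateField K N | ∀ x ∈ L, ∃ y : K, w x = w (algebraMap K N y)} ?_
  intro c hc hchain
  rcases c.eq_empty_or_nonempty with rfl | hne
  · refine ⟨⊥, fun x hx => ?_, by simp⟩
    obtain ⟨y, rfl⟩ := IntermediateField.mem_bot.mp hx
    exact ⟨y, rfl⟩
  · have : Nonempty c := hne.to_subtype
    refine ⟨⨆ E : c, E.1, fun x hx => ?_, fun E hE => le_iSup (fun E : c => E.1) ⟨E, hE⟩⟩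
    have hdir : Directed (· ≤ ·) (fun E : c => E.1) := hchain.directedOn.directed_val
    rw [← SetLike.mem_coe, IntermediateField.coe_iSup_of_directed hdir, Set.mem_iUnion] at hx
    obtain ⟨E, hE⟩ := hx
    exact hc E.2 x hE

/-- Inside an algebraically closed valued field, an intermediate field that is maximal among those
without new values is henselian. -/
theorem henselianLocalRing_of_maximal [IsAlgClosed N] [Algebra.IsAlgebraic K N]
    (W : ValuationSubring N) (L : IntermediateField K N)
    (hL : Maximal (fun L : IntermediateField K N =>
      ∀ x ∈ L, ∃ y : K, W.valuation x = W.valuation (algebraMap K N y)) L) :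
    HenselianLocalRing (W.comap (algebraMap L N)) where
  is_henselian f hf a₀ ha hu := by
    let φ : W.comap (algebraMap L N) →+* W := ValuationSubring.mapOfComapEq (algebraMap L N) rfl
    have hφ : ∀ x, ((φ x : W) : N) = ((x : L) : N) := fun _ => rfl
    have hloc : IsLocalHom φ := inferInstance
    have ha' : (f.map φ).eval (φ a₀) ∈ maximalIdeal W := by
      rw [eval_map_apply]
      exact fun h => ha (hloc.map_nonunit _ h)
    have hu' : IsUnit ((f.map φ).derivative.eval (φ a₀)) := by
      rw [derivative_map, eval_map_apply]
      exact hu.map φ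
    -- The root exists in `W`; what remains is that it lies in `L`.
    obtain ⟨α, hα, hαm⟩ := exists_isRoot_sub_mem_of_isAlgClosed W (f.map φ) (hf.map φ) _ ha'
    obtain ⟨hassoc, hder, hother⟩ := isolated_root_of_isUnit_derivative hα hαm hu'
    let ι : W.comap (algebraMap L N) →+* L := (W.comap (algebraMap L N)).subtype
    have hcomp : (algebraMap L N).comp ι = (algebraMap W N).comp φ := rfl
    have haeval : ∀ (g : (W.comap (algebraMap L N))[X]) (b : W),
        aeval (b : N) (g.map ι) = ((g.map φ).eval b : W) := by
      intro g b
      rw [aeval_def, eval₂_map, hcomp, ← eval₂_map]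
      exact eval₂_at_apply (algebraMap W N) b
    have hroot : aeval (α : N) (f.map ι) = 0 := by
      rw [haeval, hα.eq_zero, ZeroMemClass.coe_zero]
    -- If the minimal polynomial had zero derivative, it would divide `f'`, whereas `f'(α)` is a
    -- unit.
    have hsepα : IsSeparable L (α : N) := by
      rw [IsSeparable, separable_iff_derivative_ne_zero (minpoly.irreducible
        (Algebra.IsIntegral.isIntegral _))]
      intro h0
      obtain ⟨q, hq⟩ := minpoly.dvd L (α : N) hroot
      have h1 : aeval (α : N) (f.map ι).derivative = 0 := by
        rw [hq, derivative_mul, h0, zero_mul, zero_add, map_mul, minpoly.aeval, zero_mul]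
      rw [derivative_map, haeval, ← derivative_map] at h1
      exact hder.ne_zero (Subtype.ext h1)
    have hsep : IsSeparable L ((α : N) - algebraMap L N a₀) :=
      Field.isSeparable_sub hsepα (isSeparable_algebraMap _)
    have hval : W.valuation ((α : N) - algebraMap L N a₀) =
        W.valuation (algebraMap L N (f.eval a₀ : W.comap (algebraMap L N))) := by
      obtain ⟨e, he⟩ := hassoc
      have h1 := congrArg (fun t : W => W.valuation (t : N)) he
      rw [eval_map_apply] at h1
      simpa [W.valuation_unit e, hφ] using h1
    -- A conjugate of `α` is again a root of `f` in `W`, and every root other than `α` differs from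
    -- `a₀` by a unit.
    have hconj : ∀ σ : N ≃ₐ[L] N, σ ((α : N) - algebraMap L N a₀) ≠ (α : N) - algebraMap L N a₀ →
        W.valuation (σ ((α : N) - algebraMap L N a₀)) = 1 := by
      intro σ hσ
      rw [map_sub, AlgEquiv.commutes] at hσ ⊢
      have hroot' : aeval (σ (α : N)) (f.map ι) = 0 := by
        rw [← AlgEquiv.coe_toAlgHom, aeval_algHom_apply, hroot, map_zero]
      have hint : IsIntegral W (σ (α : N)) := by
        refine ⟨f.map φ, hf.map φ, ?_⟩
        rw [← hroot', eval₂_map, aeval_def, eval₂_map, hcomp]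
      obtain ⟨β, hβ⟩ := IsIntegrallyClosed.isIntegral_iff.mp hint
      have hβ' : (β : N) = σ α := hβ
      rw [← hβ', haeval] at hroot'
      have hne : β ≠ α := by
        rintro rfl
        exact hσ (by rw [← hβ'])
      rw [← hβ']
      exact W.valuation_unit (hother β (Subtype.ext hroot') hne).unit
    have hlt : W.valuation ((α : N) - algebraMap L N a₀) < 1 :=
      (W.valuation_lt_one_iff (α - φ a₀)).mp hαm
    let E : IntermediateField K N :=
      (IntermediateField.adjoin L {(α : N) - algebraMap L N a₀}).restrictScalars K
    have hE : L ≤ E := fun x hx =>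
      (IntermediateField.adjoin L {(α : N) - algebraMap L N a₀}).algebraMap_mem ⟨x, hx⟩
    have hEL : E ≤ L := by
      refine hL.2 (fun x hx => ?_) hE
      obtain ⟨y, hy⟩ := exists_valuation_eq_of_mem_adjoin W.valuation hsep hlt hconj ⟨_, hval⟩ hx
      obtain ⟨z, hz⟩ := hL.1 (y : N) y.2
      exact ⟨z, hy.trans hz⟩
    have hαL : (α : N) ∈ L := by
      have h1 : (α : N) - algebraMap L N a₀ ∈ L :=
        hEL (IntermediateField.mem_adjoin_simple_self L _)
      simpa using add_mem h1 (a₀ : L).2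
    let a : W.comap (algebraMap L N) := ⟨⟨α, hαL⟩, α.2⟩
    have hφa : φ a = α := rfl
    refine ⟨a, ValuationSubring.mapOfComapEq_injective _ rfl ?_, fun h => hαm ?_⟩
    · change φ _ = φ _
      rw [← eval_map_apply, hφa, hα.eq_zero, map_zero]
    · rw [← hφa, ← map_sub]
      exact h.map φ

/-- Every valuation ring is dominated by a henselian one with the same value group. -/
theorem exists_henselian_same_values {K : Type u} [Field K] (V : ValuationSubring K) :
    ∃ (L : Type u) (_ : Field L) (i : K →+* L) (T : ValuationSubring L),
      HenselianLocalRing T ∧ T.comap i = V ∧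
      ∀ x : L, ∃ y : K, T.valuation x = T.valuation (i y) := by
  obtain ⟨W, hW⟩ := V.exists_comap_eq (algebraMap K (AlgebraicClosure K))
  obtain ⟨L, hL⟩ := exists_maximal_same_values (K := K) W.valuation
  refine ⟨L, inferInstance, algebraMap K L, W.comap (algebraMap L _),
    henselianLocalRing_of_maximal W L hL, ?_, fun x => ?_⟩
  · rw [ValuationSubring.comap_comap, ← IsScalarTower.algebraMap_eq]
    exact hW
  · obtain ⟨y, hy⟩ := hL.1 (x : AlgebraicClosure K) x.2
    -- The restricted valuation ring has a value group of its own, so equalities of values pass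
    -- through an equivalence of valuations.
    have he : (W.comap (algebraMap L (AlgebraicClosure K))).valuation.IsEquiv
        (W.valuation.comap (algebraMap L (AlgebraicClosure K))) := by
      rw [Valuation.isEquiv_iff_valuationSubring]
      ext z
      simp [Valuation.mem_valuationSubring_iff, ValuationSubring.valuation_le_one_iff]
    exact ⟨y, (Valuation.IsEquiv.eq_iff he).mpr hy⟩

end HenselianExtension

/-! ### Amalgamation over a valuation ring. -/

section Amalgamation

open TensorProduct nonZeroDivisors

/-- Multiplication by `a` is injective on `O₁`, and tensoring with the flat module `O₂` keeps it
injective. -/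
theorem includeLeft_mem_nonZeroDivisors {V O₁ O₂ : Type*} [CommRing V] [CommRing O₁] [IsDomain O₁]
    [CommRing O₂] [Algebra V O₁] [Algebra V O₂] [Module.Flat V O₂] {a : O₁} (ha : a ≠ 0) :
    a ⊗ₜ[V] (1 : O₂) ∈ (O₁ ⊗[V] O₂)⁰ := by
  rw [mem_nonZeroDivisors_iff_right]
  intro x hx
  have hreg : IsSMulRegular (O₁ ⊗[V] O₂) a :=
    Module.Flat.isSMulRegular_of_nonZeroDivisors (mem_nonZeroDivisors_of_ne_zero ha)
  refine hreg.right_eq_zero_of_smul ?_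
  rw [← hx, Algebra.smul_def, mul_comm]
  rfl

theorem includeRight_mem_nonZeroDivisors {V O₁ O₂ : Type*} [CommRing V] [CommRing O₁]
    [CommRing O₂] [IsDomain O₂] [Algebra V O₁] [Algebra V O₂] [Module.Flat V O₁] {a : O₂}
    (ha : a ≠ 0) : (1 : O₁) ⊗ₜ[V] a ∈ (O₁ ⊗[V] O₂)⁰ := by
  have h := includeLeft_mem_nonZeroDivisors (V := V) (O₂ := O₁) ha
  rw [mem_nonZeroDivisors_iff_right] at h ⊢
  intro x hx
  refine (Algebra.TensorProduct.comm V O₁ O₂).injective ?_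
  rw [map_zero]
  refine h _ ?_
  rw [← Algebra.TensorProduct.comm_tmul, ← map_mul, hx, map_zero]

/-- Two local extensions of a local ring have a common local point: there is a prime of their tensor
product over both maximal ideals. -/
theorem exists_prime_tensorProduct {V O₁ O₂ : Type*} [CommRing V] [IsLocalRing V]
    [CommRing O₁] [IsLocalRing O₁] [CommRing O₂] [IsLocalRing O₂] [Algebra V O₁] [Algebra V O₂]
    [IsLocalHom (algebraMap V O₁)] [IsLocalHom (algebraMap V O₂)] :
    ∃ P : Ideal (O₁ ⊗[V] O₂), P.IsPrime ∧ (∀ a ∈ maximalIdeal O₁, a ⊗ₜ[V] (1 : O₂) ∈ P) ∧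
      ∀ a ∈ maximalIdeal O₂, (1 : O₁) ⊗ₜ[V] a ∈ P := by
  let κ := ResidueField V
  let B := ResidueField O₁ ⊗[κ] ResidueField O₂
  -- `B` is nonzero, being a tensor product of nonzero vector spaces over the field `κ`.
  obtain ⟨M, hM⟩ := Ideal.exists_maximal B
  let f₁ : O₁ →ₐ[V] B :=
    ((Algebra.TensorProduct.includeLeft : ResidueField O₁ →ₐ[κ] B).restrictScalars V).comp
      (IsScalarTower.toAlgHom V O₁ (ResidueField O₁))
  let f₂ : O₂ →ₐ[V] B :=
    ((Algebra.TensorProduct.includeRight : ResidueField O₂ →ₐ[κ] B).restrictScalars V).comp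
      (IsScalarTower.toAlgHom V O₂ (ResidueField O₂))
  let f : O₁ ⊗[V] O₂ →ₐ[V] B := Algebra.TensorProduct.lift f₁ f₂ fun _ _ => Commute.all _ _
  refine ⟨M.comap f, Ideal.comap_isPrime f M, fun a ha => ?_, fun a ha => ?_⟩
  · have h0 : f₁ a = 0 := by
      simp [f₁, (residue_eq_zero_iff a).mpr ha]
    rw [Ideal.mem_comap]
    simp [f, h0]
  · have h0 : f₂ a = 0 := by
      simp [f₂, (residue_eq_zero_iff a).mpr ha]
    rw [Ideal.mem_comap]
    simp [f, h0]

/-- A valuation ring is Bézout, so flatness amounts to being torsion-free. -/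
theorem flat_of_valuationRing {V O : Type*} [CommRing V] [IsDomain V] [ValuationRing V]
    [CommRing O] [IsDomain O] [Algebra V O] (h : Function.Injective (algebraMap V O)) :
    Module.Flat V O := by
  have : FaithfulSMul V O := (faithfulSMul_iff_algebraMap_injective V O).mpr h
  have : Module.IsTorsionFree V O := inferInstance
  exact Module.Flat.flat_iff_torsion_eq_bot_of_isBezout.mpr
    (Submodule.isTorsionFree_iff_torsion_eq_bot.mp this)

/-- Two local domains dominating a valuation ring are dominated by a common henselian valuation
ring. -/
theorem exists_henselian_amalgam {V O₁ O₂ : Type u} [CommRing V] [IsDomain V] [ValuationRing V]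
    [CommRing O₁] [IsDomain O₁] [IsLocalRing O₁] [CommRing O₂] [IsDomain O₂] [IsLocalRing O₂]
    (j₁ : V →+* O₁) (j₂ : V →+* O₂) [IsLocalHom j₁] [IsLocalHom j₂]
    (h₁ : Function.Injective j₁) (h₂ : Function.Injective j₂) :
    ∃ (N : Type u) (_ : Field N) (W : ValuationSubring N) (g₁ : O₁ →+* W) (g₂ : O₂ →+* W),
      HenselianLocalRing W ∧ IsLocalHom g₁ ∧ IsLocalHom g₂ ∧ Function.Injective g₁ ∧
      Function.Injective g₂ ∧ g₁.comp j₁ = g₂.comp j₂ := by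
  let _ : Algebra V O₁ := j₁.toAlgebra
  let _ : Algebra V O₂ := j₂.toAlgebra
  have hl₁ : IsLocalHom (algebraMap V O₁) := ‹IsLocalHom j₁›
  have hl₂ : IsLocalHom (algebraMap V O₂) := ‹IsLocalHom j₂›
  have : Module.Flat V O₁ := flat_of_valuationRing h₁
  have : Module.Flat V O₂ := flat_of_valuationRing h₂
  obtain ⟨P, hP, hP₁, hP₂⟩ := exists_prime_tensorProduct (V := V) (O₁ := O₁) (O₂ := O₂)
  -- A minimal prime contains no nonzerodivisor, so `O₁` and `O₂` both embed in the quotient by `q`.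
  -- Since `q ≤ P`, the localization at `P` maps to a field containing this quotient.
  obtain ⟨q, hq, hqP⟩ := Ideal.exists_minimalPrimes_le (I := (⊥ : Ideal (O₁ ⊗[V] O₂))) (J := P)
    bot_le
  have hqp : q.IsPrime := hq.1.1
  have hdisj := Ideal.disjoint_nonZeroDivisors_of_mem_minimalPrimes hq
  let A := O₁ ⊗[V] O₂
  -- The algebraic closure makes every valuation ring of `N` henselian.
  let N := AlgebraicClosure (FractionRing (A ⧸ q))
  let π : A →+* N := (algebraMap (A ⧸ q) N).comp (Ideal.Quotient.mk q)
  have hinj : Function.Injective (algebraMap (A ⧸ q) N) := by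
    rw [IsScalarTower.algebraMap_eq (A ⧸ q) (FractionRing (A ⧸ q)) N]
    exact (algebraMap (FractionRing (A ⧸ q)) N).injective.comp (IsFractionRing.injective _ _)
  have hπ : ∀ x, π x = 0 ↔ x ∈ q := by
    intro x
    rw [RingHom.comp_apply, map_eq_zero_iff _ hinj, Ideal.Quotient.eq_zero_iff_mem]
  have hunit : ∀ y : P.primeCompl, IsUnit (π y) := fun y =>
    isUnit_iff_ne_zero.mpr fun h => y.2 (hqP ((hπ _).mp h))
  let ψ : Localization.AtPrime P →+* N := IsLocalization.lift hunit
  obtain ⟨W, hmem, hloc⟩ := IsLocalRing.exists_factor_valuationRing ψ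
  let ψ' : Localization.AtPrime P →+* W := ψ.codRestrict W.toSubring hmem
  let g : A →+* W := ψ'.comp (algebraMap A (Localization.AtPrime P))
  have hg : ∀ x, ((g x : W) : N) = π x := fun x => IsLocalization.lift_eq hunit x
  have hgu : ∀ x, IsUnit (g x) → x ∉ P := by
    intro x hx hxP
    have h := hloc.map_nonunit _ hx
    exact (IsLocalization.AtPrime.isUnit_to_map_iff (Localization.AtPrime P) P x).mp h hxP
  have hg0 : ∀ x ∈ A⁰, g x ≠ 0 := by
    intro x hx h
    have : π x = 0 := by rw [← hg, h]; rfl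
    exact Set.disjoint_left.mp hdisj ((hπ x).mp this) hx
  refine ⟨N, inferInstance, W,
    g.comp (Algebra.TensorProduct.includeLeft : O₁ →ₐ[V] A).toRingHom,
    g.comp (Algebra.TensorProduct.includeRight : O₂ →ₐ[V] A).toRingHom,
    henselianLocalRing_of_isAlgClosed W, ⟨fun a ha => ?_⟩, ⟨fun a ha => ?_⟩, ?_, ?_, ?_⟩
  · by_contra h
    exact hgu _ ha (hP₁ a h)
  · by_contra h
    exact hgu _ ha (hP₂ a h)
  · refine (injective_iff_map_eq_zero _).mpr fun a ha => ?_
    by_contra h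
    exact hg0 _ (includeLeft_mem_nonZeroDivisors h) ha
  · refine (injective_iff_map_eq_zero _).mpr fun a ha => ?_
    by_contra h
    exact hg0 _ (includeRight_mem_nonZeroDivisors h) ha
  · ext x
    have : (algebraMap V O₁ x) ⊗ₜ[V] (1 : O₂) = (1 : O₁) ⊗ₜ[V] (algebraMap V O₂ x) := by
      rw [Algebra.algebraMap_eq_smul_one, Algebra.algebraMap_eq_smul_one, TensorProduct.smul_tmul]
    exact congrArg (fun t => ((g t : W) : N)) this

/-- Two local homomorphisms from the henselization to local domains dominating a valuation ring,
which agree on `R`, become equal in a common henselian valuation ring. -/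
theorem IsHenselization.exists_amalgam {R Rh : Type u} [CommRing R] [IsLocalRing R] [CommRing Rh]
    [Algebra R Rh] (hRh : IsHenselization R Rh)
    {V O₁ O₂ : Type u} [CommRing V] [IsDomain V] [ValuationRing V]
    [CommRing O₁] [IsDomain O₁] [IsLocalRing O₁] [CommRing O₂] [IsDomain O₂] [IsLocalRing O₂]
    (i : R →+* V) (j₁ : V →+* O₁) (j₂ : V →+* O₂) [IsLocalHom j₁] [IsLocalHom j₂]
    (h₁ : Function.Injective j₁) (h₂ : Function.Injective j₂)
    (φ₁ : Rh →+* O₁) (φ₂ : Rh →+* O₂) [IsLocalHom φ₁] [IsLocalHom φ₂]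
    (e₁ : φ₁.comp (algebraMap R Rh) = j₁.comp i) (e₂ : φ₂.comp (algebraMap R Rh) = j₂.comp i) :
    ∃ (N : Type u) (_ : Field N) (W : ValuationSubring N) (g₁ : O₁ →+* W) (g₂ : O₂ →+* W),
      IsLocalHom g₁ ∧ IsLocalHom g₂ ∧ Function.Injective g₁ ∧
      Function.Injective g₂ ∧ g₁.comp φ₁ = g₂.comp φ₂ := by
  obtain ⟨N, _, W, g₁, g₂, hW, hg₁, hg₂, hi₁, hi₂, hg⟩ := exists_henselian_amalgam j₁ j₂ h₁ h₂
  have := hRh.isLocalHom_algebraMap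
  refine ⟨N, _, W, g₁, g₂, hg₁, hg₂, hi₁, hi₂, ?_⟩
  have hcomp : (g₂.comp φ₂).comp (algebraMap R Rh) = (g₁.comp φ₁).comp (algebraMap R Rh) := by
    rw [RingHom.comp_assoc, RingHom.comp_assoc, e₁, e₂, ← RingHom.comp_assoc,
      ← RingHom.comp_assoc, hg]
  exact (hRh.existsUnique_lift W ((g₁.comp φ₁).comp (algebraMap R Rh))
    inferInstance).unique ⟨inferInstance, rfl⟩ ⟨inferInstance, hcomp⟩

theorem IsHenselization.ker_eq {R Rh : Type u} [CommRing R] [IsLocalRing R] [CommRing Rh]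
    [Algebra R Rh] (hRh : IsHenselization R Rh)
    {V O₁ O₂ : Type u} [CommRing V] [IsDomain V] [ValuationRing V]
    [CommRing O₁] [IsDomain O₁] [IsLocalRing O₁] [CommRing O₂] [IsDomain O₂] [IsLocalRing O₂]
    (i : R →+* V) (j₁ : V →+* O₁) (j₂ : V →+* O₂) [IsLocalHom j₁] [IsLocalHom j₂]
    (h₁ : Function.Injective j₁) (h₂ : Function.Injective j₂)
    (φ₁ : Rh →+* O₁) (φ₂ : Rh →+* O₂) [IsLocalHom φ₁] [IsLocalHom φ₂]
    (e₁ : φ₁.comp (algebraMap R Rh) = j₁.comp i) (e₂ : φ₂.comp (algebraMap R Rh) = j₂.comp i) :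
    RingHom.ker φ₁ = RingHom.ker φ₂ := by
  obtain ⟨N, _, W, g₁, g₂, -, -, hi₁, hi₂, hg⟩ :=
    hRh.exists_amalgam i j₁ j₂ h₁ h₂ φ₁ φ₂ e₁ e₂
  rw [← RingHom.ker_comp_of_injective φ₁ hi₁, hg, RingHom.ker_comp_of_injective φ₂ hi₂]

end Amalgamation

/-! ### Minimality of the kernel. -/

section Minimality

/-- If a local homomorphism from the henselization to a valuation ring over `V` is given, no prime
lies strictly below its kernel. -/
theorem IsHenselization.eq_ker_of_le {R Rh K L : Type u} [CommRing R] [IsLocalRing R] [CommRing Rh]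
    [Algebra R Rh] (hRh : IsHenselization R Rh) [Field K] [Algebra R K] [IsFractionRing R K]
    [Field L] (iL : K →+* L) {V : ValuationSubring K} {T : ValuationSubring L} (hT : T.comap iL = V)
    (i : R →+* V) (hi : ∀ r, (i r : K) = algebraMap R K r) (g : Rh →+* T) [hg : IsLocalHom g]
    (e : g.comp (algebraMap R Rh) = (ValuationSubring.mapOfComapEq iL hT).comp i)
    (P : Ideal Rh) [P.IsPrime] (hP : P ≤ RingHom.ker g) : RingHom.ker g = P := by
  have hH : (RingHom.ker g).IsPrime := RingHom.ker_isPrime g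
  set H := RingHom.ker g with hHdef
  let A := Localization.AtPrime H
  let γ : Rh →+* L := T.subtype.comp g
  have hγ : ∀ r, γ r = 0 ↔ r ∈ H := fun r => by
    rw [hHdef, RingHom.mem_ker]
    exact ⟨fun h => Subtype.ext h, fun h => congrArg Subtype.val h⟩
  have hu : ∀ y : H.primeCompl, IsUnit (γ y) := fun y =>
    isUnit_iff_ne_zero.mpr fun h => y.2 ((hγ _).mp h)
  let η : A →+* L := IsLocalization.lift hu
  have hη : ∀ r, η (algebraMap Rh A r) = g r := fun r => IsLocalization.lift_eq hu r
  have hηloc : ∀ x : A, η x ≠ 0 → IsUnit x := by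
    intro x hx
    obtain ⟨r, s, rfl⟩ := IsLocalization.exists_mk'_eq H.primeCompl x
    rw [IsLocalization.AtPrime.isUnit_mk'_iff A H]
    intro hr
    apply hx
    rw [IsLocalization.lift_mk', (hγ r).mpr hr, zero_mul]
  -- `D` is the preimage of `T` in the localization at `H`. It receives both `Rh` and `V`, and it is
  -- local because `D → T` is: an element of `A` with nonzero image in `L` is invertible in `A`.
  let D : Subring A := T.toSubring.comap η
  let ε : D →+* T := (η.comp D.subtype).codRestrict T.toSubring fun x => x.2
  have hε : IsLocalHom ε := by
    refine ⟨fun x hx => ?_⟩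
    obtain ⟨y, hy⟩ := isUnit_iff_exists_inv.mp hx
    have hy' : η x * (y : L) = 1 := congrArg Subtype.val hy
    have hxu : IsUnit (x : A) := hηloc _ fun e => by simp [e] at hy'
    obtain ⟨z, hz⟩ := isUnit_iff_exists_inv.mp hxu
    have hz' : η x * η z = 1 := by rw [← map_mul, hz, map_one]
    have hzy : η z = y := by
      rw [eq_inv_of_mul_eq_one_right hy', eq_inv_of_mul_eq_one_right hz']
    have hzD : z ∈ D := by
      change η z ∈ T
      rw [hzy]
      exact y.2
    exact isUnit_iff_exists_inv.mpr ⟨⟨z, hzD⟩, Subtype.ext hz⟩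
  have : IsLocalRing D := RingHom.domain_isLocalRing ε
  let F := FractionRing (Rh ⧸ P)
  let π : Rh →+* F := (algebraMap (Rh ⧸ P) F).comp (Ideal.Quotient.mk P)
  have hπ : ∀ r, π r = 0 ↔ r ∈ P := fun r => by
    rw [RingHom.comp_apply, map_eq_zero_iff _ (IsFractionRing.injective (Rh ⧸ P) F),
      Ideal.Quotient.eq_zero_iff_mem]
  have hπu : ∀ y : H.primeCompl, IsUnit (π y) := fun y =>
    isUnit_iff_ne_zero.mpr fun h => y.2 (hP ((hπ _).mp h))
  let ψ : A →+* F := IsLocalization.lift hπu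
  -- Since `P ≤ H`, the ring `A`, and with it `D`, maps to the fraction field of `Rh ⧸ P`. A
  -- valuation ring dominating the image of `D` receives `Rh` by a local map with kernel `P`, to be
  -- compared with `g`.
  obtain ⟨O, hmem, hloc⟩ := IsLocalRing.exists_factor_valuationRing (ψ.comp D.subtype)
  let δ : D →+* O := (ψ.comp D.subtype).codRestrict O.toSubring hmem
  have hδ : IsLocalHom δ := hloc
  let φD : Rh →+* D := (algebraMap Rh A).codRestrict D fun r => by
    change η _ ∈ T
    rw [hη]
    exact (g r).2
  have hεφ : ε.comp φD = g := RingHom.ext fun r => Subtype.ext (hη r)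
  have hφD : IsLocalHom φD := ⟨fun r hr => hg.map_nonunit _ (hεφ ▸ hr.map ε)⟩
  have hηR : ∀ r, η (algebraMap R A r) = iL (algebraMap R K r) := fun r => by
    rw [IsScalarTower.algebraMap_apply R Rh A, hη, ← hi]
    exact congrArg Subtype.val (RingHom.congr_fun e r)
  have hRu : ∀ y : nonZeroDivisors R, IsUnit (algebraMap R A y) := fun y => by
    refine hηloc _ ?_
    rw [hηR]
    exact ((IsLocalization.map_units K y).map iL).ne_zero
  let κ : K →+* A := IsLocalization.lift hRu
  have hκ : ∀ r, κ (algebraMap R K r) = algebraMap R A r := fun r => IsLocalization.lift_eq hRu r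
  have hηκ : η.comp κ = iL := by
    refine IsLocalization.ringHom_ext (nonZeroDivisors R) (RingHom.ext fun r => ?_)
    simp only [RingHom.comp_apply, hκ, hηR]
  let jD : V →+* D := (κ.comp V.subtype).codRestrict D fun x => by
    change η (κ x) ∈ T
    rw [← RingHom.comp_apply, hηκ]
    exact hT.ge x.2
  have hεj : ε.comp jD = ValuationSubring.mapOfComapEq iL hT :=
    RingHom.ext fun x => Subtype.ext (RingHom.congr_fun hηκ x)
  have hjD : IsLocalHom jD := ⟨fun x hx =>
    (ValuationSubring.isLocalHom_mapOfComapEq iL hT).map_nonunit _ (hεj ▸ hx.map ε)⟩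
  -- Injectivity is automatic because the map extends to the field `K`; that `P` lies over zero need
  -- not be known beforehand.
  have hjinj : Function.Injective (δ.comp jD) := fun x y hxy =>
    Subtype.ext ((ψ.comp κ).injective (congrArg Subtype.val hxy))
  have hcomp : (δ.comp φD).comp (algebraMap R Rh) = (δ.comp jD).comp i := by
    rw [RingHom.comp_assoc, RingHom.comp_assoc]
    congr 1
    refine RingHom.ext fun r => Subtype.ext ?_
    change algebraMap Rh A (algebraMap R Rh r) = κ (i r)
    rw [hi, hκ, ← IsScalarTower.algebraMap_apply]
  rw [hHdef, hRh.ker_eq i (ValuationSubring.mapOfComapEq iL hT) (δ.comp jD)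
    (ValuationSubring.mapOfComapEq_injective iL hT) hjinj g (δ.comp φD) e hcomp]
  ext r
  rw [RingHom.mem_ker, ← hπ, ← show ψ (algebraMap Rh A r) = π r from IsLocalization.lift_eq hπu r]
  exact ⟨fun h => congrArg Subtype.val h, fun h => Subtype.ext h⟩

end Minimality

/-! ### Centered valuations as local homomorphisms, and transport of values. -/

section CenteredValuations

/-- The inclusion of a local domain into the valuation ring of a valuation centered in it. -/
def IsCenteredIn.toValuationSubring {A : Type*} [CommRing A] [IsLocalRing A] {L : Type*} [Field L]
    [Algebra A L] {Γ : Type*} [LinearOrderedCommGroupWithZero Γ] {μ : Valuation L Γ}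
    (h : IsCenteredIn A μ) : A →+* μ.valuationSubring :=
  (algebraMap A L).codRestrict μ.valuationSubring.toSubring h.1

theorem IsCenteredIn.coe_toValuationSubring {A : Type*} [CommRing A] [IsLocalRing A] {L : Type*}
    [Field L] [Algebra A L] {Γ : Type*} [LinearOrderedCommGroupWithZero Γ] {μ : Valuation L Γ}
    (h : IsCenteredIn A μ) (a : A) : (h.toValuationSubring a : L) = algebraMap A L a := rfl

theorem IsCenteredIn.isLocalHom_toValuationSubring {A : Type*} [CommRing A] [IsLocalRing A]
    {L : Type*} [Field L] [Algebra A L] {Γ : Type*} [LinearOrderedCommGroupWithZero Γ]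
    {μ : Valuation L Γ} (h : IsCenteredIn A μ) : IsLocalHom h.toValuationSubring where
  map_nonunit a ha := by
    obtain ⟨b, hb⟩ := isUnit_iff_exists_inv.mp ha
    by_contra hna
    have h1 : μ (algebraMap A L a) < 1 := (h.2 a).mp hna
    have h2 : algebraMap A L a * (b : L) = 1 := congrArg Subtype.val hb
    have h3 : μ (algebraMap A L a) * μ b = 1 := by rw [← map_mul, h2, map_one]
    have h4 : μ (b : L) ≤ 1 := b.2
    exact absurd h3 (mul_lt_one_of_lt_of_le h1 h4).ne

theorem isCenteredIn_of_isLocalHom {A : Type*} [CommRing A] [IsLocalRing A]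
    {L : Type*} [Field L] [Algebra A L] {Γ : Type*} [LinearOrderedCommGroupWithZero Γ]
    {μ : Valuation L Γ} (φ : A →+* μ.valuationSubring) [hφ : IsLocalHom φ]
    (h : ∀ a, (φ a : L) = algebraMap A L a) : IsCenteredIn A μ := by
  have h1 : ∀ a : A, μ (algebraMap A L a) ≤ 1 := fun a => h a ▸ (φ a).2
  refine ⟨h1, fun a => ⟨fun ha => lt_of_le_of_ne (h1 a) fun he => ha ?_, fun ha hu => ?_⟩⟩
  · refine hφ.map_nonunit _ (isUnit_iff_exists_inv.mpr ⟨⟨(algebraMap A L a)⁻¹, ?_⟩, ?_⟩)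
    · rw [Valuation.mem_valuationSubring_iff, map_inv₀, he, inv_one]
    · refine Subtype.ext ?_
      rw [MulMemClass.coe_mul, h]
      exact mul_inv_cancel₀ fun h0 => by simp [h0] at he
  · obtain ⟨b, hb⟩ := isUnit_iff_exists_inv.mp hu
    have h3 : μ (algebraMap A L a) * μ (algebraMap A L b) = 1 := by
      rw [← map_mul, ← map_mul, hb, map_one, map_one]
    exact absurd h3 (mul_lt_one_of_lt_of_le ha (h1 b)).ne

/-- An injective local homomorphism of valuation rings extends to the fraction fields, and the
larger valuation ring lies over the smaller one. -/
theorem ValuationSubring.exists_comap_eq_of_isLocalHom {F N : Type*} [Field F] [Field N]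
    (O : ValuationSubring F) (W : ValuationSubring N) (g : O →+* W) [hg : IsLocalHom g]
    (hinj : Function.Injective g) :
    ∃ θ : F →+* N, (∀ x : O, θ x = g x) ∧ W.comap θ = O := by
  have hinj' : Function.Injective (W.subtype.comp g) := Subtype.val_injective.comp hinj
  let θ : F →+* N := IsFractionRing.lift (A := O) hinj'
  have hθ : ∀ x : O, θ x = g x := fun x => IsFractionRing.lift_algebraMap hinj' x
  refine ⟨θ, hθ, ValuationSubring.comap_eq_of_dominates θ O W (fun x hx => ?_) fun x hx => ?_⟩
  · rw [hθ ⟨x, hx⟩]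
    exact (g ⟨x, hx⟩).2
  · obtain ⟨hxO, hu⟩ := O.mem_nonunits_iff_exists_mem_maximalIdeal.mp hx
    rw [hθ ⟨x, hxO⟩]
    exact W.coe_mem_nonunits_iff.mpr fun h => hu (hg.map_nonunit _ h)

/-- A valuation ring over that of `ν` without new values comes from a valuation extending `ν` with
the same target. -/
theorem exists_valuation_of_same_values {K F : Type*} [Field K] [Field F] (i : K →+* F)
    {Γ : Type*} [LinearOrderedCommGroupWithZero Γ] (ν : Valuation K Γ) (O : ValuationSubring F)
    (hO : O.comap i = ν.valuationSubring)
    (hval : ∀ x : F, ∃ y : K, O.valuation x = O.valuation (i y)) :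
    ∃ μ : Valuation F Γ, μ.valuationSubring = O ∧ (∀ x, μ (i x) = ν x) ∧
      ∀ x, ∃ y, μ x = ν y := by
  have he : ν.IsEquiv (O.valuation.comap i) := by
    rw [Valuation.isEquiv_iff_valuationSubring, ← hO]
    ext z
    simp [Valuation.mem_valuationSubring_iff, ValuationSubring.valuation_le_one_iff]
  have hle : ∀ a b, ν a ≤ ν b ↔ O.valuation (i a) ≤ O.valuation (i b) := he
  have heq : ∀ a b, O.valuation (i a) = O.valuation (i b) → ν a = ν b :=
    fun a b h => le_antisymm ((hle a b).mpr h.le) ((hle b a).mpr h.ge)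
  -- Each `x` is given the `ν`-value of some `y x` in `K` with the same `O`-value. By `heq` the
  -- choice does not matter, which yields the valuation axioms.
  choose y hy using hval
  let μ : Valuation F Γ :=
    { toFun := fun x => ν (y x)
      map_zero' := by
        rw [heq (y 0) 0 (by rw [← hy, map_zero i]), map_zero]
      map_one' := by
        rw [heq (y 1) 1 (by rw [← hy, map_one i]), map_one]
      map_mul' := fun a b => by
        rw [← map_mul]
        exact heq _ _ (by rw [← hy, map_mul, map_mul, map_mul, ← hy, ← hy])
      map_add_le_max' := fun a b => by
        rw [le_max_iff, hle, hle, ← hy, ← hy, ← hy, ← le_max_iff]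
        exact O.valuation.map_add a b }
  have hμ : ∀ x, μ (i x) = ν x := fun x => heq _ _ (hy (i x)).symm
  refine ⟨μ, ?_, hμ, fun x => ⟨y x, rfl⟩⟩
  ext x
  rw [Valuation.mem_valuationSubring_iff, ← O.valuation_le_one_iff, hy x]
  have := hle (y x) 1
  rw [map_one, map_one, map_one] at this
  exact this

theorem sameValueGroup_of_forall_exists {K F : Type*} [Field K] [Field F] (i : K →+* F)
    {Γ : Type*} [LinearOrderedCommGroupWithZero Γ] (ν : Valuation K Γ) (μ : Valuation F Γ)
    (h : ∀ x, μ (i x) = ν x) (h' : ∀ x, ∃ y, μ x = ν y) : SameValueGroup i ν μ := by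
  have hS : MonoidWithZeroHom.valueGroup (MonoidWithZeroHom.ofClass ν) =
      MonoidWithZeroHom.valueGroup (MonoidWithZeroHom.ofClass μ) := by
    rw [MonoidWithZeroHom.valueGroup_def, MonoidWithZeroHom.valueGroup_def]
    congr 1
    ext b
    constructor
    · rintro ⟨x, hx⟩
      exact ⟨i x, (h x).trans hx⟩
    · rintro ⟨x, hx⟩
      obtain ⟨y, hy⟩ := h' x
      exact ⟨y, hy.symm.trans hx⟩
  -- Stated for arbitrary subgroups so that their equality can be substituted; the isomorphism is
  -- then compatible with the embeddings in `Γ`.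
  have key : ∀ (S S' : Subgroup Γˣ), S = S' → ∃ e : WithZero S ≃*o WithZero S',
      ∀ t, WithZero.map' S'.subtype (e t) = WithZero.map' S.subtype t := by
    rintro S _ rfl
    exact ⟨OrderMonoidIso.refl _, fun _ => rfl⟩
  obtain ⟨e, he⟩ := key _ _ hS
  refine ⟨e, fun x => MonoidWithZeroHom.ValueGroup₀.embedding_injective ?_⟩
  have h1 : MonoidWithZeroHom.ValueGroup₀.embedding (e (ν.restrict x)) =
      MonoidWithZeroHom.ValueGroup₀.embedding (ν.restrict x) := by
    simp only [MonoidWithZeroHom.ValueGroup₀.embedding, MonoidWithZeroHom.comp_apply, he]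
  rw [h1, Valuation.embedding_restrict, Valuation.embedding_restrict, h]

end CenteredValuations

/-! ### Uniqueness of the centered extension. -/

section CenteredExtensions

theorem fractionFieldEmbedding_algebraMap {R A K : Type*} [CommRing R] [CommRing A] [Algebra R A]
    [Field K] [Algebra R K] [IsFractionRing R K] (H : Ideal A) [H.IsPrime]
    [H.LiesOver (⊥ : Ideal R)] (r : R) :
    fractionFieldEmbedding R H K (algebraMap R K r) =
      algebraMap (A ⧸ H) (FractionRing (A ⧸ H)) (Ideal.Quotient.mk H (algebraMap R A r)) :=
  (IsFractionRing.lift_algebraMap _ r).trans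
    (IsScalarTower.algebraMap_apply R (A ⧸ H) (FractionRing (A ⧸ H)) r)

variable {R Rh K : Type u} [CommRing R] [CommRing Rh] [IsLocalRing Rh] [Algebra R Rh]
  [Field K] [Algebra R K] [IsFractionRing R K] {Γ : Type v} [LinearOrderedCommGroupWithZero Γ]
  {ν : Valuation K Γ} {H : Ideal Rh} [H.IsPrime] [H.LiesOver (⊥ : Ideal R)]
  {Γ₁ : Type w} [LinearOrderedCommGroupWithZero Γ₁] {μ : Valuation (FractionRing (Rh ⧸ H)) Γ₁}

/-- The homomorphism from `Rh` to the valuation ring of a centered extension. -/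
noncomputable def IsCenteredExtension.toValuationSubring (h : IsCenteredExtension R ν H μ) :
    Rh →+* μ.valuationSubring :=
  h.2.toValuationSubring.comp (Ideal.Quotient.mk H)

theorem IsCenteredExtension.isLocalHom_toValuationSubring (h : IsCenteredExtension R ν H μ) :
    IsLocalHom h.toValuationSubring := by
  have := h.2.isLocalHom_toValuationSubring
  have : IsLocalHom (Ideal.Quotient.mk H) :=
    IsLocalHom.of_surjective _ Ideal.Quotient.mk_surjective
  exact RingHom.isLocalHom_comp _ _

theorem IsCenteredExtension.ker_toValuationSubring (h : IsCenteredExtension R ν H μ) :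
    RingHom.ker h.toValuationSubring = H := by
  ext r
  rw [RingHom.mem_ker, ← Ideal.Quotient.eq_zero_iff_mem,
    ← map_eq_zero_iff _ (IsFractionRing.injective (Rh ⧸ H) (FractionRing (Rh ⧸ H)))]
  exact ⟨fun e => congrArg Subtype.val e, fun e => Subtype.ext e⟩

theorem IsCenteredExtension.comap_eq (h : IsCenteredExtension R ν H μ) :
    μ.valuationSubring.comap (fractionFieldEmbedding R H K) = ν.valuationSubring := h.1

theorem IsCenteredExtension.toValuationSubring_comp_algebraMap [IsLocalRing R]
    (h : IsCenteredExtension R ν H μ) (hν : IsCenteredIn R ν) :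
    h.toValuationSubring.comp (algebraMap R Rh) =
      (ValuationSubring.mapOfComapEq (fractionFieldEmbedding R H K) h.comap_eq).comp
        hν.toValuationSubring := by
  refine RingHom.ext fun r => Subtype.ext ?_
  rw [RingHom.comp_apply, RingHom.comp_apply, ValuationSubring.coe_mapOfComapEq,
    IsCenteredIn.coe_toValuationSubring, fractionFieldEmbedding_algebraMap]
  rfl

theorem IsCenteredExtension.valuationSubring_eq [IsLocalRing R] (hRh : IsHenselization R Rh)
    (hν : IsCenteredIn R ν) (h : IsCenteredExtension R ν H μ)
    {Γ'' : Type*} [LinearOrderedCommGroupWithZero Γ''] {μ' : Valuation (FractionRing (Rh ⧸ H)) Γ''}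
    (h' : IsCenteredExtension R ν H μ') : μ.valuationSubring = μ'.valuationSubring := by
  have := h.isLocalHom_toValuationSubring
  have := h'.isLocalHom_toValuationSubring
  obtain ⟨N, _, W, g₁, g₂, _, _, hi₁, hi₂, hg⟩ := hRh.exists_amalgam hν.toValuationSubring
    (ValuationSubring.mapOfComapEq (fractionFieldEmbedding R H K) h.comap_eq)
    (ValuationSubring.mapOfComapEq (fractionFieldEmbedding R H K) h'.comap_eq)
    (ValuationSubring.mapOfComapEq_injective _ h.comap_eq)
    (ValuationSubring.mapOfComapEq_injective _ h'.comap_eq)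
    h.toValuationSubring h'.toValuationSubring
    (h.toValuationSubring_comp_algebraMap hν) (h'.toValuationSubring_comp_algebraMap hν)
  obtain ⟨θ₁, hθ₁, hW₁⟩ := μ.valuationSubring.exists_comap_eq_of_isLocalHom W g₁ hi₁
  obtain ⟨θ₂, hθ₂, hW₂⟩ := μ'.valuationSubring.exists_comap_eq_of_isLocalHom W g₂ hi₂
  -- Both embeddings of the fraction field agree on the image of `Rh`, hence everywhere, so both
  -- valuation rings are the preimage of `W` under one map.
  have hθ : θ₁ = θ₂ := by
    refine IsLocalization.ringHom_ext (nonZeroDivisors (Rh ⧸ H)) (RingHom.ext fun a => ?_)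
    obtain ⟨r, rfl⟩ := Ideal.Quotient.mk_surjective a
    exact (hθ₁ (h.toValuationSubring r)).trans ((congrArg Subtype.val
      (RingHom.congr_fun hg r)).trans (hθ₂ (h'.toValuationSubring r)).symm)
  rw [← hW₁, ← hW₂, hθ]

end CenteredExtensions

/-! ### Assembly of the theorem. -/

theorem theorem1 {R Rh K : Type u} [CommRing R] [IsDomain R] [IsLocalRing R]
    [Field K] [Algebra R K] [IsFractionRing R K]
    [CommRing Rh] [IsLocalRing Rh] [Algebra R Rh] (hRh : IsHenselization R Rh)
    {Γ : Type v} [LinearOrderedCommGroupWithZero Γ] (ν : Valuation K Γ) (hν : IsCenteredIn R ν) :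
    ∃ (H : Ideal Rh) (_ : H.IsPrime) (_ : H.LiesOver (⊥ : Ideal R))
      (μ : Valuation (FractionRing (Rh ⧸ H)) Γ),
      -- `ν` extends to a valuation `μ` centered in `Rh ⧸ H`
      IsCenteredExtension R ν H μ ∧
      -- `H` is the only prime over zero for which there is such an extension
      (∀ (H' : Ideal Rh) [H'.IsPrime] [H'.LiesOver (⊥ : Ideal R)]
        (Γ' : Type w) [LinearOrderedCommGroupWithZero Γ']
        (μ' : Valuation (FractionRing (Rh ⧸ H')) Γ'), IsCenteredExtension R ν H' μ' → H' = H) ∧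
      -- `H` is a minimal prime
      H ∈ minimalPrimes Rh ∧
      -- the extension is unique (as a valuation, that is, up to equivalence)
      (∀ (Γ' : Type w) [LinearOrderedCommGroupWithZero Γ']
        (μ' : Valuation (FractionRing (Rh ⧸ H)) Γ'), IsCenteredExtension R ν H μ' → μ'.IsEquiv μ) ∧
      -- the value group does not change
      SameValueGroup (fractionFieldEmbedding R H K) ν μ := by
  obtain ⟨L, _, iL, T, hTh, hT, hTval⟩ := exists_henselian_same_values ν.valuationSubring
  have := hν.isLocalHom_toValuationSubring
  let j := ValuationSubring.mapOfComapEq iL hT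
  -- Only the existence of the lift is used here; its uniqueness enters through amalgamation.
  obtain ⟨g, ⟨hg, hgR⟩, -⟩ := hRh.existsUnique_lift T (j.comp hν.toValuationSubring)
    inferInstance
  have hHp : (RingHom.ker g).IsPrime := RingHom.ker_isPrime g
  have hinj : Function.Injective (j.comp hν.toValuationSubring) :=
    (ValuationSubring.mapOfComapEq_injective iL hT).comp fun a b hab =>
      IsFractionRing.injective R K (congrArg Subtype.val hab)
  have hHo : (RingHom.ker g).LiesOver (⊥ : Ideal R) := ⟨by
    rw [Ideal.under_def, RingHom.comap_ker, hgR, (RingHom.injective_iff_ker_eq_bot _).mp hinj]⟩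
  let H := RingHom.ker g
  let F := FractionRing (Rh ⧸ H)
  have hker : Function.Injective (T.subtype.comp g.kerLift) :=
    Subtype.val_injective.comp g.kerLift_injective
  let θ : F →+* L := IsFractionRing.lift hker
  have hθ : ∀ r, θ (algebraMap (Rh ⧸ H) F (Ideal.Quotient.mk H r)) = g r := fun r =>
    IsFractionRing.lift_algebraMap hker _
  have hθK : θ.comp (fractionFieldEmbedding R H K) = iL := by
    refine IsLocalization.ringHom_ext (nonZeroDivisors R) (RingHom.ext fun r => ?_)
    simp only [RingHom.comp_apply]
    rw [fractionFieldEmbedding_algebraMap, hθ]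
    exact congrArg Subtype.val (RingHom.congr_fun hgR r)
  have hO : (T.comap θ).comap (fractionFieldEmbedding R H K) = ν.valuationSubring := by
    rw [ValuationSubring.comap_comap, hθK, hT]
  -- `F` sits between `K` and `L`, and `T` already takes no values beyond those on `K`.
  have hval : ∀ x : F, ∃ y : K, (T.comap θ).valuation x =
      (T.comap θ).valuation (fractionFieldEmbedding R H K y) := by
    intro x
    have he : (T.comap θ).valuation.IsEquiv (T.valuation.comap θ) := by
      rw [Valuation.isEquiv_iff_valuationSubring]
      ext z
      simp [Valuation.mem_valuationSubring_iff, ValuationSubring.valuation_le_one_iff]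
    obtain ⟨y, hy⟩ := hTval (θ x)
    refine ⟨y, (Valuation.IsEquiv.eq_iff he).mpr ?_⟩
    rw [← hθK] at hy
    exact hy
  obtain ⟨μ, hμO, hμν, hμval⟩ :=
    exists_valuation_of_same_values (fractionFieldEmbedding R H K) ν (T.comap θ) hO hval
  let φ : Rh ⧸ H →+* μ.valuationSubring :=
    (algebraMap (Rh ⧸ H) F).codRestrict μ.valuationSubring.toSubring fun a => by
      obtain ⟨r, rfl⟩ := Ideal.Quotient.mk_surjective a
      change _ ∈ μ.valuationSubring
      rw [hμO, ValuationSubring.mem_comap, hθ]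
      exact (g r).2
  have hφ : IsLocalHom φ := by
    refine ⟨fun a ha => ?_⟩
    obtain ⟨r, rfl⟩ := Ideal.Quotient.mk_surjective a
    have h1 := ha.map (ValuationSubring.mapOfComapEq θ hμO.symm)
    have h2 : ValuationSubring.mapOfComapEq θ hμO.symm (φ (Ideal.Quotient.mk H r)) = g r :=
      Subtype.ext (hθ r)
    rw [h2] at h1
    exact (hg.map_nonunit _ h1).map _
  have hμ : IsCenteredExtension R ν H μ :=
    ⟨by rw [ValuationExtends, hμO, hO], isCenteredIn_of_isLocalHom φ fun _ => rfl⟩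
  refine ⟨H, hHp, hHo, μ, hμ, ?_, ⟨⟨hHp, bot_le⟩, ?_⟩, ?_,
    sameValueGroup_of_forall_exists _ ν μ hμν hμval⟩
  · intro H' _ _ Γ' _ μ' h'
    have := h'.isLocalHom_toValuationSubring
    rw [← h'.ker_toValuationSubring]
    exact hRh.ker_eq hν.toValuationSubring
      (ValuationSubring.mapOfComapEq (fractionFieldEmbedding R H' K) h'.comap_eq) j
      (ValuationSubring.mapOfComapEq_injective _ h'.comap_eq)
      (ValuationSubring.mapOfComapEq_injective iL hT) _ g
      (h'.toValuationSubring_comp_algebraMap hν) hgR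
  · rintro P ⟨hP, -⟩ hPH
    exact (hRh.eq_ker_of_le iL hT hν.toValuationSubring (fun _ => rfl) g hgR P hPH).le
  · intro Γ' _ μ' h'
    rw [Valuation.isEquiv_iff_valuationSubring]
    exact h'.valuationSubring_eq hRh hν hμ
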